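/- Let $(\Omega,\mathcal F,\mathbb P)$ be a complete probability space carrying a one-dimensional Brownian motion $B$, let $\mathbb F=(\mathcal F_t)_{t\ge0}$ be the augmented right-continuous filtration generated by $B$, and let $\mathcal I=(\alpha,\infty)$ with $-\infty\le\alpha<0$. Let $\mu,\sigma$ be Lipschitz on $\mathcal I$ with $\sigma>0$ on $\mathcal I$, let $U:\mathcal I\to\mathbb R_+$ be measurable and let $r\in\mathbb R$. Let $\mathbb L$ be the set of $\mathbb F$-adapted processes $L$ that are a.s. non-decreasing and right-continuous, with $L_{0-}=0$. For $x\in\mathcal I$ and $L\in\mathbb L$, let $X^L$ be the strong solution of $dX^L_t=\mu(X^L_t)\,dt+\sigma(X^L_t)\,dB_t-dL_t$, $X^L_{0-}=x$, and let $$\mathcal A(x)=\{L\in\mathbb L:\ X^L_t\in\mathcal I\ \text{and}\ (X^L_{t-})^+-(\Delta L)_t\ge0\ \text{for all }t\}.$$ Let $Q$ be a probability law on $\mathbb R$ with density $f$, where for some $\bar y>0$ the function $f$ is positive and Lipschitz on $[0,\bar y]$ and vanishes outside $[0,\bar y]$; let $F$ be its distribution function. On $(\Omega\times\mathbb R,\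 \overline{\mathbb P}=\mathbb P\otimes Q)$, with expectation $\overline{\mathbb E}$, let $Y(\omega,y)=y$, so that $Y$ has law $Q$ and is independent of $B$. Put $\tau_y=\inf\{t\ge0: X^L_t\le y\}$, with $\inf\emptyset=\infty$; on $\{\tau=\infty\}$ read $[0,\tau]$ as $[0,\infty)$ and $e^{-r\tau}U(X^L_\tau)$ as $0$. The value of the tipping-point problem, in which a threshold $Y\ge X^L_{0-}=x$ counts as already reached at time $0-$, before any extraction, and pays $U(x)$, is $$\overline V(x)=\sup_{L\in\mathcal A(x)}\overline{\mathbb E}\Big[\mathbf 1_{\{Y<x\}}\Big(\int_{[0,\tau_Y]}e^{-rs}\,dL_s+e^{-r\tau_Y}U(X^L_{\tau_Y})\Big)+\mathbf 1_{\{Y\ge x\}}U(x)\Big].$$ For $m\le x$ let $M^L_t=m\wedge\inf_{s\le t}X^L_s$, $M^L_{0-}=m$, let $M^{L,c}$ be the continuous part of $M^L$, and let $V(x,m)=\sup_{L\in\mathcal A(x)}V(x,m;L)$, where $$V(x,m;L)=\mathbb E\Big[\int_{[0,\tau_0]}e^{-rs}F(M^L_{s-})\,dL_s\Big]-\mathbb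 E\Big[\int_{[0,\tau_0]}e^{-rs}U(M^L_s)f(M^L_s)\,dM^{L,c}_s\Big]+\mathbb E\Big[\sum_{0\le s\le\tau_0}e^{-rs}U(M^L_s)\big(F(M^L_{s-})-F(M^L_s)\big)\Big].$$ All the quantities are non-negative, possibly $+\infty$, and $\sup\emptyset=-\infty$. Then, for every $x\in\mathcal I$, $$\overline V(x)=V(x,x)+U(x)\,(1-F(x)).$$ -/

import Mathlib

open MeasureTheory ProbabilityTheory Filter Set
open scoped NNReal ENNReal Topology

namespace TippingPoint

/-! ### Paths started at time `0-` -/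

section Paths

/-- Extension of a path `A : [0,∞) → ℝ` to all of `ℝ` by its value `a = A_{0-}` before time `0`.
The left limit of the extension at `t ≥ 0` is then `A_{t-}`, also for `t = 0`. -/
noncomputable def extendPath (a : ℝ) (A : ℝ≥0 → ℝ) : ℝ → ℝ :=
  fun t => if t < 0 then a else A t.toNNReal

/-- The value `A_{t-}`, where `A_{0-} = a`. -/
noncomputable def preValue (a : ℝ) (A : ℝ≥0 → ℝ) (t : ℝ) : ℝ :=
  Function.leftLim (extendPath a A) t

open scoped Classical in
/-- The Lebesgue-Stieltjes measure `dA` on `[0,∞)` (seen as a measure on `ℝ`) of a non-decreasing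
right-continuous path with `A_{0-} = a`; it has the atom `A_0 - a` at time `0`. Paths that are not
non-decreasing and right-continuous (they only occur on null sets) get the zero measure. -/
noncomputable def pathMeasure (a : ℝ) (A : ℝ≥0 → ℝ) : Measure ℝ :=
  if h : Monotone (extendPath a A) ∧
      ∀ t, ContinuousWithinAt (extendPath a A) (Ici t) t then
    (StieltjesFunction.mk (extendPath a A) h.1 h.2).measure
  else 0

/-- The continuous part of a measure on the line: all atoms are removed. If the measure is `dA`,
this is `dA^c`, where `A^c` is the continuous part of `A`. -/
noncomputable def continuousPart (ν : Measure ℝ) : Measure ℝ :=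
  ν.restrict {s | ν {s} = 0}

/-- The time interval `[0, τ]`, which is `[0,∞)` if `τ = ∞`. -/
def timeInterval (τ : ℝ≥0∞) : Set ℝ :=
  {s | 0 ≤ s ∧ ENNReal.ofReal s ≤ τ}

/-- The hitting time `τ_y = inf {t ≥ 0 : X_t ≤ y}`, with `inf ∅ = ∞`. -/
noncomputable def hitBelow (X : ℝ≥0 → ℝ) (y : ℝ) : ℝ≥0∞ :=
  ⨅ (t : ℝ≥0) (_ : X t ≤ y), (t : ℝ≥0∞)

/-- The running minimum `M_t = m ∧ inf_{s ≤ t} X_s`. -/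
noncomputable def runMin (m : ℝ) (X : ℝ≥0 → ℝ) (t : ℝ≥0) : ℝ :=
  min m (⨅ s : Iic t, X s)

end Paths

/-! ### The Brownian filtration and the Itô integral -/

section Stochastic

variable {Ω : Type*} [mΩ : MeasurableSpace Ω]

/-- The augmented (by all `P`-null sets) right-continuous filtration generated by the Brownian
motion `B` on a complete probability space. -/
noncomputable def brownianFiltration {P : Measure Ω} [P.IsComplete] {B : ℝ≥0 → Ω → ℝ}
    (hB : IsBrownianReal B P) : Filtration ℝ≥0 mΩ :=
  Filtration.rightCont
    (Filtration.natural B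
        (fun t => (hB.toIsPreBrownianReal.aemeasurable t).nullMeasurable.measurable_of_complete
          |>.stronglyMeasurable) ⊔
      Filtration.const ℝ≥0 (MeasurableSpace.generateFrom {N : Set Ω | P N = 0})
        (MeasurableSpace.generateFrom_le fun _ hN => measurableSet_of_null hN))

/-- Simple predictable processes `∑_{i < n} ξ_i 1_{(t_i, t_{i+1}]}` with bounded
`𝓕_{t_i}`-measurable coefficients `ξ_i`. -/
structure SimpleIntegrand (𝓕 : Filtration ℝ≥0 mΩ) where
  /-- the number of steps -/
  n : ℕ
  /-- the grid -/
  time : ℕ → ℝ≥0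
  /-- the coefficients -/
  coef : ℕ → Ω → ℝ
  mono : Monotone time
  meas : ∀ i, Measurable[𝓕 (time i)] (coef i)
  bdd : ∃ C : ℝ, ∀ i ω, |coef i ω| ≤ C

/-- The value at time `t` of a simple process. -/
noncomputable def SimpleIntegrand.value {𝓕 : Filtration ℝ≥0 mΩ} (S : SimpleIntegrand 𝓕)
    (t : ℝ≥0) (ω : Ω) : ℝ :=
  ∑ i ∈ Finset.range S.n, (Ioc (S.time i) (S.time (i + 1))).indicator (fun _ => S.coef i ω) t

/-- The elementary integral `∫_0^t S dB` of a simple process. -/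
noncomputable def SimpleIntegrand.integral {𝓕 : Filtration ℝ≥0 mΩ} (S : SimpleIntegrand 𝓕)
    (B : ℝ≥0 → Ω → ℝ) (t : ℝ≥0) (ω : Ω) : ℝ :=
  ∑ i ∈ Finset.range S.n, S.coef i ω * (B (min (S.time (i + 1)) t) ω - B (min (S.time i) t) ω)

/-- `I` is (a continuous adapted version of) the Itô integral `∫_0^· H dB`: the integrand is
pathwise locally square integrable, and there are simple processes `S_k` such that, for every
horizon `T`, `∫_0^T |S_k - H|² ds → 0` and `sup_{t ≤ T} |∫_0^t S_k dB - I_t| → 0` in probability.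
This determines `I` up to indistinguishability. -/
structure IsItoIntegral (𝓕 : Filtration ℝ≥0 mΩ) (P : Measure Ω) (B H I : ℝ≥0 → Ω → ℝ) : Prop where
  adapted : Adapted 𝓕 I
  continuous : ∀ᵐ ω ∂P, Continuous fun t => I t ω
  locallySquareIntegrable : ∀ᵐ ω ∂P, ∀ T : ℝ≥0,
    MemLp (fun s : ℝ => H s.toNNReal ω) 2 (volume.restrict (Icc 0 (T : ℝ)))
  approx : ∃ S : ℕ → SimpleIntegrand 𝓕, ∀ (T : ℝ≥0) (ε : ℝ), 0 < ε →
    Tendsto (fun k => P {ω | ENNReal.ofReal ε ≤ ∫⁻ s in Icc 0 (T : ℝ),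
        ENNReal.ofReal (((S k).value s.toNNReal ω - H s.toNNReal ω) ^ 2)}) atTop (𝓝 0) ∧
    Tendsto (fun k => P {ω | ∃ t ≤ T, ε ≤ |(S k).integral B t ω - I t ω|}) atTop (𝓝 0)

/-- The set `𝕃` of controls: adapted processes that are almost surely non-decreasing and
right-continuous, with `L_{0-} = 0` (so that `L_0 ≥ 0` may be a jump). -/
structure IsControl (𝓕 : Filtration ℝ≥0 mΩ) (P : Measure Ω) (L : ℝ≥0 → Ω → ℝ) : Prop where
  adapted : Adapted 𝓕 L
  mono : ∀ᵐ ω ∂P, 0 ≤ L 0 ω ∧ Monotone fun t => L t ω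
  rightCont : ∀ᵐ ω ∂P, ∀ t, ContinuousWithinAt (fun s => L s ω) (Ici t) t

/-- `X` is a strong solution of `dX_t = μ(X_t) dt + σ(X_t) dB_t - dL_t`, `X_{0-} = x`. -/
structure IsControlledDiffusion (𝓕 : Filtration ℝ≥0 mΩ) (P : Measure Ω) (B : ℝ≥0 → Ω → ℝ)
    (μ σ : ℝ → ℝ) (x : ℝ) (L X : ℝ≥0 → Ω → ℝ) : Prop where
  adapted : Adapted 𝓕 X
  drift_integrable : ∀ᵐ ω ∂P, ∀ t : ℝ≥0,
    IntervalIntegrable (fun s : ℝ => μ (X s.toNNReal ω)) volume 0 t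
  equation : ∃ I : ℝ≥0 → Ω → ℝ, IsItoIntegral 𝓕 P B (fun t ω => σ (X t ω)) I ∧
    ∀ᵐ ω ∂P, ∀ t : ℝ≥0,
      X t ω = x + (∫ s in (0 : ℝ)..t, μ (X s.toNNReal ω)) + I t ω - L t ω

/-- The state space `(α, ∞)`, `-∞ ≤ α`. -/
def stateSpace (α : EReal) : Set ℝ := {y | α < (y : EReal)}

/-- `L ∈ 𝒜(x)` with controlled process `X = X^L`: almost surely, for all `t`, `X_t` lies in the
state space and `(X_{t-})⁺ - ΔL_t ≥ 0`. -/
structure IsAdmissible (𝓕 : Filtration ℝ≥0 mΩ) (P : Measure Ω) (B : ℝ≥0 → Ω → ℝ)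
    (α : EReal) (μ σ : ℝ → ℝ) (x : ℝ) (L X : ℝ≥0 → Ω → ℝ) : Prop where
  control : IsControl 𝓕 P L
  diffusion : IsControlledDiffusion 𝓕 P B μ σ x L X
  mem_stateSpace : ∀ᵐ ω ∂P, ∀ t, X t ω ∈ stateSpace α
  jump_le : ∀ᵐ ω ∂P, ∀ t : ℝ≥0,
    0 ≤ max (preValue x (fun s => X s ω) t) 0 - (L t ω - preValue 0 (fun s => L s ω) t)

/-! ### The two control problems -/

/-- The discounted continuation value `e^{-rτ} U(X_τ)`, which is `0` if `τ = ∞`. -/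
noncomputable def discountedValue (r : ℝ) (U : ℝ → ℝ) (X : ℝ≥0 → ℝ) (τ : ℝ≥0∞) : ℝ≥0∞ :=
  if τ = ∞ then 0 else ENNReal.ofReal (Real.exp (-r * τ.toReal) * U (X τ.toNNReal))

/-- The reward `∫_{[0,τ_y]} e^{-rs} dL_s + e^{-rτ_y} U(X_{τ_y})` along a path with `X_{0-} = x` if
the threshold is `y`. If `x ≤ y`, the threshold has been reached at time `0-`, before any
extraction, and the reward is the continuation value `U(x)`. -/
noncomputable def pathReward (r : ℝ) (U : ℝ → ℝ) (x : ℝ) (L X : ℝ≥0 → ℝ) (y : ℝ) : ℝ≥0∞ :=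
  if x ≤ y then ENNReal.ofReal (U x)
  else (∫⁻ s in timeInterval (hitBelow X y), ENNReal.ofReal (Real.exp (-r * s)) ∂pathMeasure 0 L) +
    discountedValue r U X (hitBelow X y)

/-- The expected reward of the tipping-point problem, on the product space `Ω × ℝ` with law
`P ⊗ Q` and the threshold `Y(ω, y) = y`. -/
noncomputable def tippingReward (P : Measure Ω) (Q : Measure ℝ) (r : ℝ) (U : ℝ → ℝ) (x : ℝ)
    (L X : ℝ≥0 → Ω → ℝ) : ℝ≥0∞ :=
  ∫⁻ p : Ω × ℝ, pathReward r U x (fun t => L t p.1) (fun t => X t p.1) p.2 ∂(P.prod Q)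

/-- The value `V̄(x)` of the tipping-point problem: the supremum over all admissible controls
(`sup ∅ = -∞`). -/
noncomputable def tippingValue (𝓕 : Filtration ℝ≥0 mΩ) (P : Measure Ω) (B : ℝ≥0 → Ω → ℝ)
    (α : EReal) (μ σ : ℝ → ℝ) (Q : Measure ℝ) (r : ℝ) (U : ℝ → ℝ) (x : ℝ) : EReal :=
  ⨆ (L : ℝ≥0 → Ω → ℝ) (X : ℝ≥0 → Ω → ℝ) (_ : IsAdmissible 𝓕 P B α μ σ x L X),
    ((tippingReward P Q r U x L X : ℝ≥0∞) : EReal)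

/-- `E ∫_{[0,τ_0]} e^{-rs} F(M_{s-}) dL_s`. -/
noncomputable def extractionTerm (P : Measure Ω) (F : ℝ → ℝ) (r m : ℝ)
    (L X : ℝ≥0 → Ω → ℝ) : ℝ≥0∞ :=
  ∫⁻ ω, ∫⁻ s in timeInterval (hitBelow (fun t => X t ω) 0),
    ENNReal.ofReal (Real.exp (-r * s) * F (preValue m (runMin m fun t => X t ω) s))
      ∂pathMeasure 0 (fun t => L t ω) ∂P

/-- `-E ∫_{[0,τ_0]} e^{-rs} U(M_s) f(M_s) dM^c_s`, written with the positive measure `-dM^c`, the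
continuous part of `d(-M)`. -/
noncomputable def continuousTerm (P : Measure Ω) (f : ℝ → ℝ) (r : ℝ) (U : ℝ → ℝ) (m : ℝ)
    (X : ℝ≥0 → Ω → ℝ) : ℝ≥0∞ :=
  ∫⁻ ω, ∫⁻ s in timeInterval (hitBelow (fun t => X t ω) 0),
    ENNReal.ofReal (Real.exp (-r * s) * (U (runMin m (fun t => X t ω) s.toNNReal) *
      f (runMin m (fun t => X t ω) s.toNNReal)))
      ∂continuousPart (pathMeasure (-m) fun t => -runMin m (fun u => X u ω) t) ∂P

/-- `E ∑_{0 ≤ s ≤ τ_0} e^{-rs} U(M_s) (F(M_{s-}) - F(M_s))`, a sum of non-negative terms over all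
times. -/
noncomputable def jumpTerm (P : Measure Ω) (F : ℝ → ℝ) (r : ℝ) (U : ℝ → ℝ) (m : ℝ)
    (X : ℝ≥0 → Ω → ℝ) : ℝ≥0∞ :=
  ∫⁻ ω, ∑' s : timeInterval (hitBelow (fun t => X t ω) 0),
    ENNReal.ofReal (Real.exp (-r * s) * (U (runMin m (fun t => X t ω) (s : ℝ).toNNReal) *
      (F (preValue m (runMin m fun t => X t ω) s) -
        F (runMin m (fun t => X t ω) (s : ℝ).toNNReal)))) ∂P

/-- The reward `V(x, m; L)` of the singular control problem for the diffusion `X = X^L` and its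
running minimum. -/
noncomputable def singularReward (P : Measure Ω) (F f : ℝ → ℝ) (r : ℝ) (U : ℝ → ℝ) (m : ℝ)
    (L X : ℝ≥0 → Ω → ℝ) : ℝ≥0∞ :=
  extractionTerm P F r m L X + continuousTerm P f r U m X + jumpTerm P F r U m X

/-- The value `V(x, m)` of the singular control problem (`sup ∅ = -∞`). -/
noncomputable def singularValue (𝓕 : Filtration ℝ≥0 mΩ) (P : Measure Ω) (B : ℝ≥0 → Ω → ℝ)
    (α : EReal) (μ σ : ℝ → ℝ) (F f : ℝ → ℝ) (r : ℝ) (U : ℝ → ℝ) (x m : ℝ) : EReal :=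
  ⨆ (L : ℝ≥0 → Ω → ℝ) (X : ℝ≥0 → Ω → ℝ) (_ : IsAdmissible 𝓕 P B α μ σ x L X),
    ((singularReward P F f r U m L X : ℝ≥0∞) : EReal)

end Stochastic

/-- `Q` is the law of a non-negative threshold with density `f`, where `f` is positive and
Lipschitz on `[0, ȳ]` for some `ȳ > 0` and vanishes elsewhere. -/
structure IsThresholdLaw (Q : Measure ℝ) (f : ℝ → ℝ) : Prop where
  isProbabilityMeasure : IsProbabilityMeasure Q
  density : Q = volume.withDensity fun y => ENNReal.ofReal (f y)
  shape : ∃ ybar : ℝ, 0 < ybar ∧ (∃ K : ℝ≥0, LipschitzOnWith K f (Icc 0 ybar)) ∧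
    (∀ y ∈ Icc 0 ybar, 0 < f y) ∧ ∀ y, y ∉ Icc 0 ybar → f y = 0

end TippingPoint

open TippingPoint

/-!
For a fixed admissible control `L` the rewards of the two problems agree up to the constant
`U(x) (1 - F(x))`, so the suprema agree as well, also if they are infinite or taken over the empty
set. The constant is the contribution of the thresholds `y ≥ x`. For the others, integrate over the
threshold first, along one path at a time. Let `M` be the running minimum of the path of `X`
started from `x`. For `y < x` the passage time `τ_y` of `X` is also that of `M`, and
`X_{τ_y} = M_{τ_y}`.

* Up to one value of `y`, `s ≤ τ_y` means `y < M_{s-}`. By Tonelli's theorem the extraction at time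
  `s` therefore has weight `Q(Y < M_{s-}) = F(M_{s-})` (`lintegral_cdf_preValue_eq`).
* The map `y ↦ τ_y` is the generalised inverse of `M`, so it carries Lebesgue measure on the levels
  that are reached to the measure `-dM` (`pathMeasure_neg_eq_map`). Up to countably many `y`, either
  `M` is continuous at `τ_y`, and then `M_{τ_y} = y`, or `M` jumps at `τ_y` and overshoots,
  `M_{τ_y} < y`. The levels of the first kind contribute the integral of `U(M) f(M)` against `-dM^c`
  (`lintegral_continuousPart_eq`); no continuity of `f` is needed. Those of the second kind are, for
  each jump time `s`, the levels between `M_s` and `M_{s-}`, and they contribute the sum over the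
  jumps (`tsum_cdf_jump_eq`).
* Thresholds below `0` have probability zero, which is why the terms of the singular control problem
  may be stopped at `τ_0`.

What is used of `X` is that it is right-continuous and has only downward jumps, since it is the sum
of a continuous process and `-L`. It is then lower semicontinuous and attains its minimum over
`[0, t]`, so that `τ_y ≤ t` if and only if `M_t ≤ y`. This makes passage times jointly measurable in
the scenario and the level. The integrals against `dL` are jointly measurable because
`pathMeasure_neg_eq_map`, applied to `-L`, turns them into Lebesgue integrals.
-/

namespace TippingPoint

/-! ### First passage times and the running minimum -/

section Hitting

variable {X : ℝ≥0 → ℝ} {x y : ℝ}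

theorem hitBelow_le_iff (hX : ∀ t, ContinuousWithinAt X (Ici t) t) (t : ℝ≥0) :
    hitBelow X y ≤ t ↔ ∃ s ≤ t, X s ≤ y := by
  constructor
  · intro h
    by_contra! hc
    obtain ⟨u, hu, hIco⟩ := mem_nhdsGE_iff_exists_Ico_subset.1
      ((hX t).eventually_const_lt (hc t le_rfl))
    have : (u : ℝ≥0∞) ≤ hitBelow X y := by
      refine le_iInf₂ fun s hs => ?_
      by_contra! hsu
      have hsu' : s < u := by exact_mod_cast hsu
      rcases le_or_gt s t with hst | hst
      · exact (hc s hst).not_ge hs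
      · exact (show y < X s from hIco ⟨hst.le, hsu'⟩).not_ge hs
    have hut : (u : ℝ≥0∞) ≤ t := this.trans h
    exact (show t < u from hu).not_ge (by exact_mod_cast hut)
  · rintro ⟨s, hst, hs⟩
    exact (iInf₂_le s hs).trans (by exact_mod_cast hst)

theorem hitBelow_antitone (X : ℝ≥0 → ℝ) : Antitone (hitBelow X) := fun _ _ h =>
  le_iInf₂ fun s hs => iInf₂_le s (hs.trans h)

theorem hitBelow_le_iff_of_antitone (hX : ∀ t, ContinuousWithinAt X (Ici t) t)
    (hm : Antitone X) (t : ℝ≥0) : hitBelow X y ≤ t ↔ X t ≤ y := by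
  rw [hitBelow_le_iff hX]
  exact ⟨fun ⟨s, hs, h⟩ => (hm hs).trans h, fun h => ⟨t, le_rfl, h⟩⟩

theorem exists_forall_le_of_lowerSemicontinuous (hX : LowerSemicontinuous X) (t : ℝ≥0) :
    ∃ s ≤ t, ∀ u ≤ t, X s ≤ X u := by
  obtain ⟨s, hs, h⟩ := (hX.lowerSemicontinuousOn (Icc 0 t)).exists_isMinOn
    (nonempty_Icc.2 (zero_le)) isCompact_Icc
  exact ⟨s, hs.2, fun u hu => h ⟨zero_le, hu⟩⟩

theorem exists_runMin_eq (hX : LowerSemicontinuous X) (m : ℝ) (t : ℝ≥0) :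
    ∃ s ≤ t, runMin m X t = min m (X s) ∧ ∀ u ≤ t, X s ≤ X u := by
  obtain ⟨s, hs, h⟩ := exists_forall_le_of_lowerSemicontinuous hX t
  refine ⟨s, hs, ?_, h⟩
  have hbdd : BddBelow (range fun s : Iic t => X s) :=
    ⟨X s, by rintro _ ⟨u, rfl⟩; exact h u u.2⟩
  have : Nonempty (Iic t) := ⟨⟨t, le_refl t⟩⟩
  rw [runMin]
  congr 1
  exact le_antisymm (ciInf_le hbdd ⟨s, hs⟩) (le_ciInf fun u => h u u.2)

theorem runMin_le_iff (hX : LowerSemicontinuous X) (t : ℝ≥0) :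
    runMin x X t ≤ y ↔ x ≤ y ∨ ∃ s ≤ t, X s ≤ y := by
  obtain ⟨s, hs, heq, h⟩ := exists_runMin_eq hX x t
  rw [heq, min_le_iff]
  exact or_congr_right ⟨fun h' => ⟨s, hs, h'⟩, fun ⟨u, hu, h'⟩ => (h u hu).trans h'⟩

theorem runMin_lt_iff (hX : LowerSemicontinuous X) (t : ℝ≥0) :
    runMin x X t < y ↔ x < y ∨ ∃ s ≤ t, X s < y := by
  obtain ⟨s, hs, heq, h⟩ := exists_runMin_eq hX x t
  rw [heq, min_lt_iff]
  exact or_congr_right ⟨fun h' => ⟨s, hs, h'⟩, fun ⟨u, hu, h'⟩ => (h u hu).trans_lt h'⟩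

theorem runMin_le (X : ℝ≥0 → ℝ) (t : ℝ≥0) : runMin x X t ≤ x := min_le_left _ _

theorem antitone_runMin (hX : LowerSemicontinuous X) : Antitone (runMin x X) := fun s t hst => by
  rw [runMin_le_iff hX]
  exact ((runMin_le_iff hX s).1 le_rfl).imp_right fun ⟨u, hu, h⟩ => ⟨u, hu.trans hst, h⟩

theorem continuousWithinAt_runMin (hX : LowerSemicontinuous X)
    (hX' : ∀ t, ContinuousWithinAt X (Ici t) t) (t : ℝ≥0) :
    ContinuousWithinAt (runMin x X) (Ici t) t := by
  refine tendsto_order.2 ⟨fun c hc => ?_, fun c hc => ?_⟩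
  · have hc' := not_or.1 (mt (runMin_le_iff hX t).2 hc.not_ge)
    push Not at hc'
    obtain ⟨u, hu, hIco⟩ := mem_nhdsGE_iff_exists_Ico_subset.1
      ((hX' t).eventually_const_lt (hc'.2 t le_rfl))
    filter_upwards [Ico_mem_nhdsGE hu] with s hs
    rw [← not_le, runMin_le_iff hX]
    push Not
    refine ⟨hc'.1, fun v hv => ?_⟩
    rcases le_or_gt v t with hvt | hvt
    · exact hc'.2 v hvt
    · exact hIco ⟨hvt.le, hv.trans_lt hs.2⟩
  · filter_upwards [self_mem_nhdsWithin] with s hs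
    exact (antitone_runMin hX hs).trans_lt hc

theorem hitBelow_runMin (hX : LowerSemicontinuous X)
    (hX' : ∀ t, ContinuousWithinAt X (Ici t) t) (hy : y < x) :
    hitBelow (runMin x X) y = hitBelow X y := by
  refine eq_of_forall_ge_iff fun c => ?_
  induction c with
  | top => simp
  | coe t =>
    rw [hitBelow_le_iff hX', hitBelow_le_iff_of_antitone (continuousWithinAt_runMin hX hX')
      (antitone_runMin hX), runMin_le_iff hX]
    simp [hy.not_ge]

theorem le_of_hitBelow_ne_top (hX : ∀ t, ContinuousWithinAt X (Ici t) t)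
    (h : hitBelow X y ≠ ∞) : X (hitBelow X y).toNNReal ≤ y := by
  obtain ⟨s, hs, hy⟩ := (hitBelow_le_iff hX _).1 (ENNReal.coe_toNNReal h).ge
  have : hitBelow X y ≤ s := iInf₂_le s hy
  have hs' : (hitBelow X y).toNNReal ≤ s := by
    rwa [← ENNReal.coe_le_coe, ENNReal.coe_toNNReal h]
  rwa [← le_antisymm hs hs']

/-- At the first passage time below a level `y < x` the path is at its running minimum. -/
theorem runMin_hitBelow (hX : LowerSemicontinuous X)
    (hX' : ∀ t, ContinuousWithinAt X (Ici t) t) (hy : y < x) (h : hitBelow X y ≠ ∞) :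
    runMin x X (hitBelow X y).toNNReal = X (hitBelow X y).toNNReal := by
  have h1 := le_of_hitBelow_ne_top hX' h
  refine le_antisymm ((runMin_le_iff hX _).2 (Or.inr ⟨_, le_rfl, le_rfl⟩)) ?_
  rw [← not_lt, runMin_lt_iff hX]
  push Not
  refine ⟨h1.trans hy.le, fun s hs => ?_⟩
  by_contra! hlt
  have : hitBelow X y ≤ s := iInf₂_le s (hlt.le.trans h1)
  have hs' : (hitBelow X y).toNNReal ≤ s := by
    rwa [← ENNReal.coe_le_coe, ENNReal.coe_toNNReal h]
  rw [le_antisymm hs hs'] at hlt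
  exact lt_irrefl _ hlt

end Hitting

/-! ### Stieltjes measures and left limits of non-increasing paths -/

section Extended

variable {Z : ℝ≥0 → ℝ} {z y : ℝ}

theorem antitone_extendPath (hm : Antitone Z) (hz : ∀ t, Z t ≤ z) :
    Antitone (extendPath z Z) := by
  intro s t hst
  unfold extendPath
  split_ifs with h1 h2 h2
  · exact le_rfl
  · exact absurd (hst.trans_lt h1) h2
  · exact hz _
  · exact hm (Real.toNNReal_mono hst)

theorem extendPath_of_nonneg (z : ℝ) (Z : ℝ≥0 → ℝ) {t : ℝ} (ht : 0 ≤ t) :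
    extendPath z Z t = Z t.toNNReal := if_neg ht.not_gt

theorem continuousWithinAt_extendPath (hc : ∀ t, ContinuousWithinAt Z (Ici t) t) (z t : ℝ) :
    ContinuousWithinAt (extendPath z Z) (Ici t) t := by
  rcases lt_or_ge t 0 with ht | ht
  · refine ContinuousAt.continuousWithinAt (continuousAt_const.congr (f := fun _ => z) ?_)
    filter_upwards [Iio_mem_nhds ht] with s hs
    exact (if_pos hs).symm
  · have h1 : ContinuousWithinAt (fun s : ℝ => Z s.toNNReal) (Ici t) t :=
      (hc t.toNNReal).comp continuous_real_toNNReal.continuousWithinAt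
        fun s hs => Real.toNNReal_mono hs
    exact h1.congr (fun s hs => extendPath_of_nonneg z Z (ht.trans hs))
      (extendPath_of_nonneg z Z ht)

/-- First passage times as a generalised inverse of a non-increasing path. -/
theorem hitBelow_toReal_le_iff (hc : ∀ t, ContinuousWithinAt Z (Ici t) t) (hm : Antitone Z)
    (hy : y < z) (t : ℝ) :
    (hitBelow Z y ≠ ∞ ∧ (hitBelow Z y).toReal ≤ t) ↔ extendPath z Z t ≤ y := by
  rcases lt_or_ge t 0 with ht | ht
  · simp only [extendPath, if_pos ht, hy.not_ge, iff_false, not_and, not_le]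
    exact fun _ => ht.trans_le ENNReal.toReal_nonneg
  · rw [extendPath_of_nonneg z Z ht, ← hitBelow_le_iff_of_antitone hc hm]
    constructor
    · rintro ⟨h, h'⟩
      exact (ENNReal.le_ofReal_iff_toReal_le h ht).2 h'
    · intro h
      have : hitBelow Z y ≠ ∞ := (h.trans_lt ENNReal.coe_lt_top).ne
      exact ⟨this, (ENNReal.le_ofReal_iff_toReal_le this ht).1 h⟩

theorem measurable_hitBelow (Z : ℝ≥0 → ℝ) : Measurable (hitBelow Z) :=
  (hitBelow_antitone Z).measurable

/-- The Lebesgue-Stieltjes measure of a monotone path is the image of Lebesgue measure under the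
generalised inverse of the path, that is, under its first passage times. -/
theorem pathMeasure_neg_eq_map (hc : ∀ t, ContinuousWithinAt Z (Ici t) t) (hm : Antitone Z)
    (hz : ∀ t, Z t ≤ z) :
    pathMeasure (-z) (fun t => -Z t) =
      (volume.restrict {y | y < z ∧ hitBelow Z y ≠ ∞}).map fun y => (hitBelow Z y).toReal := by
  have hneg : extendPath (-z) (fun t => -Z t) = fun t => -extendPath z Z t := by
    ext t
    unfold extendPath
    split_ifs <;> rfl
  have hanti := antitone_extendPath hm hz
  have hcond : Monotone (extendPath (-z) fun t => -Z t) ∧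
      ∀ t, ContinuousWithinAt (extendPath (-z) fun t => -Z t) (Ici t) t := by
    rw [hneg]
    exact ⟨hanti.neg, fun t => (continuousWithinAt_extendPath hc z t).neg⟩
  rw [pathMeasure, dif_pos hcond]
  refine Measure.ext_of_Ioc _ _ fun a b hab => ?_
  have hmeas : Measurable fun y => (hitBelow Z y).toReal := (measurable_hitBelow Z).ennreal_toReal
  rw [StieltjesFunction.measure_Ioc, Measure.map_apply hmeas measurableSet_Ioc,
    Measure.restrict_apply (hmeas measurableSet_Ioc)]
  have hset : (fun y => (hitBelow Z y).toReal) ⁻¹' Ioc a b ∩ {y | y < z ∧ hitBelow Z y ≠ ∞} =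
      Ico (extendPath z Z b) (extendPath z Z a) := by
    ext y
    simp only [mem_inter_iff, mem_preimage, mem_Ioc, mem_ofPred_eq, mem_Ico]
    constructor
    · rintro ⟨⟨h1, h2⟩, h3, h4⟩
      refine ⟨(hitBelow_toReal_le_iff hc hm h3 b).1 ⟨h4, h2⟩, ?_⟩
      by_contra! h5
      exact ((hitBelow_toReal_le_iff hc hm h3 a).2 h5).2.not_gt h1
    · rintro ⟨h1, h2⟩
      have h3 : y < z := by
        refine h2.trans_le ?_
        unfold extendPath
        split_ifs
        exacts [le_rfl, hz _]
      obtain ⟨h4, h5⟩ := (hitBelow_toReal_le_iff hc hm h3 b).2 h1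
      refine ⟨⟨?_, h5⟩, h3, h4⟩
      by_contra! h6
      exact ((hitBelow_toReal_le_iff hc hm h3 a).1 ⟨h4, h6⟩).not_gt h2
  rw [hset, Real.volume_Ico]
  simp only [hneg]
  congr 1
  ring

theorem preValue_le (hm : Antitone Z) (hz : ∀ t, Z t ≤ z) {s : ℝ} : preValue z Z s ≤ z := by
  have h := (antitone_extendPath hm hz).leftLim_le
    (show min s 0 - 1 < s by linarith [min_le_left s 0])
  rwa [extendPath, if_pos (by linarith [min_le_right s 0])] at h

theorem lt_of_lt_preValue (hm : Antitone Z) (hz : ∀ t, Z t ≤ z) {s : ℝ}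
    (h : y < preValue z Z s) {t : ℝ≥0} (ht : t < s) : y < Z t := by
  refine h.trans_le ?_
  have h' := (antitone_extendPath hm hz).leftLim_le ht
  have h0 := extendPath_of_nonneg z Z t.coe_nonneg
  rw [Real.toNNReal_coe] at h0
  exact h'.trans_eq h0

theorem le_preValue (hm : Antitone Z) (hz : ∀ t, Z t ≤ z) {s : ℝ} (hy : y ≤ z)
    (h : ∀ t : ℝ≥0, t < s → y ≤ Z t) : y ≤ preValue z Z s := by
  refine ge_of_tendsto ((antitone_extendPath hm hz).tendsto_leftLim s) ?_
  filter_upwards [self_mem_nhdsWithin] with t ht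
  unfold extendPath
  split_ifs with h0
  · exact hy
  · exact h _ (by rwa [Real.coe_toNNReal _ (not_lt.1 h0)])

theorem le_preValue_self (hm : Antitone Z) (hz : ∀ t, Z t ≤ z) {s : ℝ} :
    Z s.toNNReal ≤ preValue z Z s :=
  le_preValue hm hz (hz _) fun t ht => hm <| by
    rw [← NNReal.coe_le_coe]; exact ht.le.trans (Real.le_coe_toNNReal s)

theorem mem_timeInterval_hitBelow (hm : Antitone Z) (hz : ∀ t, Z t ≤ z) {s : ℝ} (hs : 0 ≤ s)
    (h : y < preValue z Z s) : s ∈ timeInterval (hitBelow Z y) := by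
  refine ⟨hs, le_iInf₂ fun t ht => ?_⟩
  by_contra! hts
  have : (t : ℝ) < s := by
    exact Real.lt_toNNReal_iff_coe_lt.1 (ENNReal.coe_lt_coe.1 hts)
  exact (lt_of_lt_preValue hm hz h this).not_ge ht

theorem le_preValue_of_mem_timeInterval (hm : Antitone Z) (hz : ∀ t, Z t ≤ z) {s : ℝ}
    (hy : y < z) (h : s ∈ timeInterval (hitBelow Z y)) : y ≤ preValue z Z s := by
  refine le_preValue hm hz hy.le fun t ht => ?_
  by_contra! hlt
  have h1 : hitBelow Z y ≤ t := iInf₂_le t hlt.le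
  have h2 := h.2.trans h1
  have h3 : s.toNNReal ≤ t := ENNReal.coe_le_coe.1 h2
  exact ht.not_ge (Real.toNNReal_le_iff_le_coe.1 h3)

theorem countable_lt_preValue (hm : Antitone Z) (hz : ∀ t, Z t ≤ z) :
    {s : ℝ | 0 ≤ s ∧ Z s.toNNReal < preValue z Z s}.Countable := by
  have hsub : {s : ℝ | 0 ≤ s ∧ Z s.toNNReal < preValue z Z s} ⊆
      {s | ¬ContinuousAt (extendPath z Z) s} := by
    rintro s ⟨hs, hlt⟩
    rw [mem_ofPred_eq]
    intro hcont
    have h : preValue z Z s = extendPath z Z s := hcont.continuousWithinAt.leftLim_eq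
    rw [extendPath_of_nonneg z Z hs] at h
    exact hlt.ne' h
  exact (antitone_extendPath hm hz).countable_not_continuousAt.mono hsub

theorem measurableSet_timeInterval (τ : ℝ≥0∞) : MeasurableSet (timeInterval τ) :=
  measurableSet_Ici.inter (measurableSet_le ENNReal.measurable_ofReal measurable_const)

end Extended

/-! ### Joint measurability in the scenario and the threshold -/

section Measurability

variable {Ω : Type*} [MeasurableSpace Ω] {Z L : ℝ≥0 → Ω → ℝ}

/-- Measurable approximation from the right by grid points, here `(⌊(n + 1) t⌋ + 1) / (n + 1)`. -/
theorem exists_grid_tendsto_nhdsGE :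
    ∃ (k : ℕ → ℝ≥0 → ℕ) (g : ℕ → ℕ → ℝ≥0), (∀ n, Measurable (k n)) ∧
      ∀ t, Tendsto (fun n => g n (k n t)) atTop (𝓝[≥] t) := by
  refine ⟨fun n t => ⌊((n : ℝ≥0) + 1) * t⌋₊, fun n j => ((j : ℝ≥0) + 1) / ((n : ℝ≥0) + 1),
    fun n => Nat.measurable_floor.comp (measurable_id.const_mul _), fun t => ?_⟩
  have hpos : ∀ n : ℕ, (0 : ℝ≥0) < (n : ℝ≥0) + 1 := fun n => by positivity
  have h1 : ∀ n : ℕ, t ≤ ((⌊((n : ℝ≥0) + 1) * t⌋₊ : ℝ≥0) + 1) / ((n : ℝ≥0) + 1) := fun n => by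
    rw [le_div_iff₀ (hpos n), mul_comm]
    exact (Nat.lt_floor_add_one _).le
  have h2 : ∀ n : ℕ, ((⌊((n : ℝ≥0) + 1) * t⌋₊ : ℝ≥0) + 1) / ((n : ℝ≥0) + 1) ≤
      t + 1 / ((n : ℝ≥0) + 1) := fun n => by
    rw [div_le_iff₀ (hpos n), add_mul t, div_mul_cancel₀ _ (hpos n).ne', mul_comm t]
    exact add_le_add_left (Nat.floor_le zero_le) 1
  refine tendsto_nhdsWithin_iff.2 ⟨?_, Eventually.of_forall h1⟩
  refine tendsto_of_tendsto_of_tendsto_of_le_of_le tendsto_const_nhds ?_ h1 h2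
  simpa using (tendsto_const_nhds (x := t)).add
    (tendsto_one_div_add_atTop_nhds_zero_nat (𝕜 := ℝ≥0))

theorem measurable_uncurry_of_rightCont
    (hc : ∀ ω t, ContinuousWithinAt (fun s => Z s ω) (Ici t) t) (hmeas : ∀ t, Measurable (Z t)) :
    Measurable fun p : ℝ≥0 × Ω => Z p.1 p.2 := by
  obtain ⟨k, g, hk, hlim⟩ := exists_grid_tendsto_nhdsGE
  refine measurable_of_tendsto_metrizable (f := fun n p => Z (g n (k n p.1)) p.2) (fun n => ?_)
    (tendsto_pi_nhds.2 fun p => ?_)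
  swap
  · exact (hc p.2 p.1).tendsto.comp (hlim p.1)
  have h1 : Measurable fun q : ℕ × Ω => Z (g n q.1) q.2 :=
    measurable_from_prod_countable_right fun j => hmeas (g n j)
  exact h1.comp (((hk n).comp measurable_fst).prodMk measurable_snd)

theorem measurable_hitBelow_prod
    (hc : ∀ ω t, ContinuousWithinAt (fun s => Z s ω) (Ici t) t)
    (hm : ∀ ω, Antitone fun t => Z t ω) (hmeas : ∀ t, Measurable (Z t)) :
    Measurable fun p : Ω × ℝ => hitBelow (fun t => Z t p.1) p.2 := by
  refine measurable_of_Iic fun c => ?_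
  induction c with
  | top => simp
  | coe t =>
    have : (fun p : Ω × ℝ => hitBelow (fun t => Z t p.1) p.2) ⁻¹' Iic (t : ℝ≥0∞) =
        {p | Z t p.1 ≤ p.2} := by
      ext p
      exact hitBelow_le_iff_of_antitone (hc p.1) (hm p.1) t
    rw [this]
    exact measurableSet_le ((hmeas t).comp measurable_fst) measurable_snd

theorem measurable_value_hitBelow_prod
    (hc : ∀ ω t, ContinuousWithinAt (fun s => Z s ω) (Ici t) t)
    (hm : ∀ ω, Antitone fun t => Z t ω) (hmeas : ∀ t, Measurable (Z t)) :
    Measurable fun p : Ω × ℝ => Z (hitBelow (fun t => Z t p.1) p.2).toNNReal p.1 :=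
  (measurable_uncurry_of_rightCont hc hmeas).comp
    ((measurable_hitBelow_prod hc hm hmeas).ennreal_toNNReal.prodMk measurable_fst)

theorem measurable_discountedValue_prod
    (hc : ∀ ω t, ContinuousWithinAt (fun s => Z s ω) (Ici t) t)
    (hm : ∀ ω, Antitone fun t => Z t ω) (hmeas : ∀ t, Measurable (Z t))
    (r : ℝ) {U : ℝ → ℝ} (hU : Measurable U) :
    Measurable fun p : Ω × ℝ =>
      discountedValue r U (fun t => Z t p.1) (hitBelow (fun t => Z t p.1) p.2) := by
  have hhit := measurable_hitBelow_prod hc hm hmeas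
  unfold discountedValue
  refine Measurable.ite (hhit (measurableSet_singleton ∞)) measurable_const ?_
  exact ((Real.measurable_exp.comp (hhit.ennreal_toReal.const_mul _)).mul
    (hU.comp (measurable_value_hitBelow_prod hc hm hmeas))).ennreal_ofReal

/-- The discounted extraction up to a random time is measurable in all parameters: the integral
against `dL` is a Lebesgue integral over the values of `L`. -/
theorem measurable_lintegral_timeInterval
    (hc : ∀ ω t, ContinuousWithinAt (fun s => L s ω) (Ici t) t)
    (hm : ∀ ω, Monotone fun t => L t ω) (h0 : ∀ ω, 0 ≤ L 0 ω) (hmeas : ∀ t, Measurable (L t))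
    (r : ℝ) {τ : Ω × ℝ → ℝ≥0∞} (hτ : Measurable τ) :
    Measurable fun p : Ω × ℝ => ∫⁻ s in timeInterval (τ p),
      ENNReal.ofReal (Real.exp (-r * s)) ∂pathMeasure 0 (fun t => L t p.1) := by
  have hmeasE : Measurable fun s : ℝ => ENNReal.ofReal (Real.exp (-r * s)) := by fun_prop
  have hlam : Measurable fun q : (Ω × ℝ) × ℝ => hitBelow (fun t => -L t q.1.1) q.2 :=
    (measurable_hitBelow_prod (Z := fun t ω => -L t ω) (fun ω t => (hc ω t).neg)
      (fun ω => (hm ω).neg) (fun t => (hmeas t).neg)).comp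
      ((measurable_fst.comp measurable_fst).prodMk measurable_snd)
  let K : Set ((Ω × ℝ) × ℝ) := {q | (hitBelow (fun t => -L t q.1.1) q.2).toReal ∈
    timeInterval (τ q.1) ∧ (q.2 < 0 ∧ hitBelow (fun t => -L t q.1.1) q.2 ≠ ∞)}
  have hK : MeasurableSet K := by
    refine MeasurableSet.inter (MeasurableSet.inter ?_ ?_) (MeasurableSet.inter ?_ ?_)
    · exact measurableSet_le measurable_const hlam.ennreal_toReal
    · exact measurableSet_le hlam.ennreal_toReal.ennreal_ofReal (hτ.comp measurable_fst)
    · exact measurableSet_lt measurable_snd measurable_const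
    · exact (hlam (measurableSet_singleton ∞)).compl
  have key : ∀ p : Ω × ℝ, ∫⁻ s in timeInterval (τ p),
      ENNReal.ofReal (Real.exp (-r * s)) ∂pathMeasure 0 (fun t => L t p.1) =
      ∫⁻ u, K.indicator (fun q => ENNReal.ofReal
        (Real.exp (-r * (hitBelow (fun t => -L t q.1.1) q.2).toReal))) (p, u) := by
    intro p
    have hmap := pathMeasure_neg_eq_map (Z := fun t => -L t p.1) (z := 0)
      (fun t => (hc p.1 t).neg) (hm p.1).neg
      (fun t => neg_nonpos.2 ((h0 p.1).trans (hm p.1 zero_le)))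
    simp only [neg_zero, neg_neg] at hmap
    have hg : Measurable fun u => (hitBelow (fun t => -L t p.1) u).toReal :=
      (measurable_hitBelow _).ennreal_toReal
    rw [hmap, setLIntegral_map (measurableSet_timeInterval _) hmeasE hg,
      Measure.restrict_restrict (hg (measurableSet_timeInterval _)), ← lintegral_indicator]
    · rfl
    · exact (hg (measurableSet_timeInterval _)).inter (measurableSet_Iio.inter
        ((measurable_hitBelow _ (measurableSet_singleton ∞)).compl))
  simp_rw [key]
  exact Measurable.lintegral_prod_right'
    ((hmeasE.comp hlam.ennreal_toReal).indicator hK)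

theorem measurable_runMin {X : ℝ≥0 → Ω → ℝ} (hl : ∀ ω, LowerSemicontinuous fun t => X t ω)
    (hc : ∀ ω t, ContinuousWithinAt (fun s => X s ω) (Ici t) t) (hmeas : ∀ t, Measurable (X t))
    (x : ℝ) (t : ℝ≥0) : Measurable fun ω => runMin x (fun s => X s ω) t := by
  obtain ⟨D, hD, hDd⟩ := TopologicalSpace.exists_countable_dense ℝ≥0
  refine measurable_of_Iio fun c => ?_
  have : (fun ω => runMin x (fun s => X s ω) t) ⁻¹' Iio c =
      {_ω | x < c} ∪ ({ω | X t ω < c} ∪ ⋃ q ∈ D ∩ Iio t, {ω | X q ω < c}) := by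
    ext ω
    simp only [mem_preimage, mem_Iio, mem_union, mem_ofPred_eq, mem_iUnion, exists_prop]
    rw [runMin_lt_iff (hl ω)]
    refine or_congr_right ⟨?_, ?_⟩
    · rintro ⟨s, hs, h⟩
      rcases hs.eq_or_lt with rfl | hst
      · exact Or.inl h
      · -- the path stays below `c` on an interval to the right of `s`
        obtain ⟨u, hu, hIco⟩ := mem_nhdsGE_iff_exists_Ico_subset.1
          ((hc ω s).eventually_lt_const h)
        obtain ⟨q, hq, hqD⟩ := hDd.exists_between (lt_min hst (show s < u from hu))
        exact Or.inr ⟨q, ⟨hq, (hqD.2.trans_le (min_le_left _ _))⟩,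
          hIco ⟨hqD.1.le, hqD.2.trans_le (min_le_right _ _)⟩⟩
    · rintro (h | ⟨q, hq, h⟩)
      · exact ⟨t, le_rfl, h⟩
      · exact ⟨q, (show q < t from hq.2).le, h⟩
  rw [this]
  refine (MeasurableSet.const _).union ((measurableSet_lt (hmeas t) measurable_const).union ?_)
  exact MeasurableSet.biUnion (hD.mono inter_subset_left)
    fun q _ => measurableSet_lt (hmeas q) measurable_const

end Measurability

/-! ### The reward along one path, integrated over the threshold -/

section Pathwise

variable {Z : ℝ≥0 → ℝ} {z r : ℝ} {Q : Measure ℝ} {U f : ℝ → ℝ} {τ : ℝ≥0∞}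

instance (a : ℝ) (A : ℝ≥0 → ℝ) : SFinite (pathMeasure a A) := by
  unfold pathMeasure
  split_ifs <;> infer_instance

theorem measure_Ico_eq_cdf [IsProbabilityMeasure Q] [NullSingletonClass Q] (a b : ℝ) :
    Q (Ico a b) = ENNReal.ofReal (cdf Q b - cdf Q a) := by
  rw [measure_congr Ico_ae_eq_Ioc, ← StieltjesFunction.measure_Ioc, measure_cdf]

theorem measure_Iio_eq_cdf [IsProbabilityMeasure Q] [NullSingletonClass Q] (a : ℝ) :
    Q (Iio a) = ENNReal.ofReal (cdf Q a) := by
  rw [measure_congr Iio_ae_eq_Iic, ofReal_cdf]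

theorem cdf_eq_zero_of_nonpos [IsProbabilityMeasure Q] (hQ : Q (Iic 0) = 0) {a : ℝ}
    (ha : a ≤ 0) : cdf Q a = 0 := by
  rw [cdf_eq_real, Measure.real, measure_mono_null (Iic_subset_Iic.2 ha) hQ, ENNReal.toReal_zero]

theorem ae_mem_timeInterval_iff (μ : Measure ℝ) [NullSingletonClass μ] (hm : Antitone Z)
    (hz : ∀ t, Z t ≤ z) {s : ℝ} (hs : 0 ≤ s) :
    ∀ᵐ y ∂μ, (y < z ∧ s ∈ timeInterval (hitBelow Z y)) ↔ y < preValue z Z s := by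
  filter_upwards [(countable_singleton (preValue z Z s)).ae_notMem μ] with y hy
  constructor
  · rintro ⟨h1, h2⟩
    exact (le_preValue_of_mem_timeInterval hm hz h1 h2).lt_of_ne hy
  · exact fun h => ⟨h.trans_le (preValue_le hm hz), mem_timeInterval_hitBelow hm hz hs h⟩

/-- The levels passed at time `s` are those between `Z_s` and `Z_{s-}`. -/
theorem ae_hitBelow_eq_iff (μ : Measure ℝ) [NullSingletonClass μ]
    (hc : ∀ t, ContinuousWithinAt Z (Ici t) t) (hm : Antitone Z) (hz : ∀ t, Z t ≤ z)
    {s : ℝ} (hs : 0 ≤ s) :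
    ∀ᵐ y ∂μ, (y < z ∧ hitBelow Z y = ENNReal.ofReal s) ↔
      y ∈ Ico (Z s.toNNReal) (preValue z Z s) := by
  filter_upwards [ae_mem_timeInterval_iff μ hm hz hs] with y hy
  rw [mem_Ico, ← hy, le_antisymm_iff, ← hitBelow_le_iff_of_antitone hc hm]
  exact ⟨fun h => ⟨h.2.1, h.1, hs, h.2.2⟩, fun h => ⟨h.2.1, h.1, h.2.2.2⟩⟩

/-- For almost every level, the path jumps at the passage time if and only if it overshoots. -/
theorem ae_lt_preValue_hitBelow_iff (μ : Measure ℝ) [NullSingletonClass μ]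
    (hc : ∀ t, ContinuousWithinAt Z (Ici t) t) (hm : Antitone Z) (hz : ∀ t, Z t ≤ z) :
    ∀ᵐ y ∂μ, y < z → hitBelow Z y ≠ ∞ →
      (Z (hitBelow Z y).toNNReal < preValue z Z (hitBelow Z y).toReal ↔
        Z (hitBelow Z y).toNNReal ≠ y) := by
  filter_upwards [((countable_lt_preValue hm hz).image fun s => Z s.toNNReal).ae_notMem μ]
    with y hy h1 h2
  have htime : ((hitBelow Z y).toReal).toNNReal = (hitBelow Z y).toNNReal := Real.toNNReal_coe
  constructor
  · intro h heq
    exact hy ⟨_, ⟨ENNReal.toReal_nonneg, by rwa [htime]⟩, (congrArg Z htime).trans heq⟩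
  · intro h
    refine ((le_of_hitBelow_ne_top hc h2).lt_of_ne h).trans_le ?_
    exact le_preValue_of_mem_timeInterval hm hz h1
      ⟨ENNReal.toReal_nonneg, (ENNReal.ofReal_toReal h2).le⟩

/-- The hypothesis on `τ`, which `τ_0` satisfies, says that `Z` has reached `(-∞, 0]` before any
time after `τ`. A threshold law without mass on `(-∞, 0]` then gives no weight to such times. -/
theorem preValue_nonpos_of_notMem (hm : Antitone Z) (hz : ∀ t, Z t ≤ z)
    (hτ : ∀ s, 0 ≤ s → s ∉ timeInterval τ → ∃ t : ℝ≥0, (t : ℝ) < s ∧ Z t ≤ 0) {s : ℝ}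
    (hs : 0 ≤ s) (h : s ∉ timeInterval τ) : preValue z Z s ≤ 0 := by
  obtain ⟨t, ht, h0⟩ := hτ s hs h
  by_contra! hlt
  exact (lt_of_lt_preValue hm hz hlt ht).not_ge h0

/-- By Tonelli's theorem, the extraction at time `s` is weighted by the probability `F(Z_{s-})`
that the threshold has not been reached before `s`. -/
theorem lintegral_cdf_preValue_eq [IsProbabilityMeasure Q] [NullSingletonClass Q]
    (hQ : Q (Iic 0) = 0) (hm : Antitone Z) (hz : ∀ t, Z t ≤ z)
    (hτ : ∀ s, 0 ≤ s → s ∉ timeInterval τ → ∃ t : ℝ≥0, (t : ℝ) < s ∧ Z t ≤ 0)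
    (r : ℝ) (ν : Measure ℝ) [SFinite ν] :
    ∫⁻ s in timeInterval τ, ENNReal.ofReal (Real.exp (-r * s) * cdf Q (preValue z Z s)) ∂ν =
      ∫⁻ y in Iio z, ∫⁻ s in timeInterval (hitBelow Z y),
        ENNReal.ofReal (Real.exp (-r * s)) ∂ν ∂Q := by
  let K : Set (ℝ × ℝ) := {p | p.1 < z ∧ p.2 ∈ timeInterval (hitBelow Z p.1)}
  have hK : MeasurableSet K := by
    refine MeasurableSet.inter ?_ (MeasurableSet.inter ?_ ?_)
    · exact measurableSet_lt measurable_fst measurable_const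
    · exact measurableSet_le measurable_const measurable_snd
    · exact measurableSet_le measurable_snd.ennreal_ofReal
        ((measurable_hitBelow Z).comp measurable_fst)
  have hE : Measurable fun s : ℝ => ENNReal.ofReal (Real.exp (-r * s)) := by fun_prop
  have h1 : ∫⁻ y in Iio z, ∫⁻ s in timeInterval (hitBelow Z y),
        ENNReal.ofReal (Real.exp (-r * s)) ∂ν ∂Q =
      ∫⁻ y, ∫⁻ s, K.indicator (fun p => ENNReal.ofReal (Real.exp (-r * p.2))) (y, s) ∂ν ∂Q := by
    rw [← lintegral_indicator measurableSet_Iio]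
    refine lintegral_congr fun y => ?_
    by_cases hy : y < z
    · rw [indicator_of_mem (show y ∈ Iio z from hy),
        ← lintegral_indicator (measurableSet_timeInterval _)]
      refine lintegral_congr fun s => ?_
      by_cases hs : s ∈ timeInterval (hitBelow Z y)
      · rw [indicator_of_mem hs, indicator_of_mem (show (y, s) ∈ K from ⟨hy, hs⟩)]
      · rw [indicator_of_notMem hs, indicator_of_notMem (show (y, s) ∉ K from fun h => hs h.2)]
    · rw [indicator_of_notMem (show y ∉ Iio z from hy)]
      refine (lintegral_eq_zero_of_ae_eq_zero (Eventually.of_forall fun s => ?_)).symm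
      exact indicator_of_notMem (show (y, s) ∉ K from fun h => hy h.1) _
  have hmeasK : Measurable (Function.uncurry fun y s =>
      K.indicator (fun p => ENNReal.ofReal (Real.exp (-r * p.2))) (y, s)) :=
    (hE.comp measurable_snd).indicator hK
  rw [h1, lintegral_lintegral_swap hmeasK.aemeasurable,
    ← lintegral_indicator (measurableSet_timeInterval τ)]
  refine lintegral_congr fun s => ?_
  by_cases hs : 0 ≤ s
  · have h2 : ∫⁻ y, K.indicator (fun p => ENNReal.ofReal (Real.exp (-r * p.2))) (y, s) ∂Q =
        ENNReal.ofReal (Real.exp (-r * s) * cdf Q (preValue z Z s)) := by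
      rw [ENNReal.ofReal_mul (Real.exp_pos _).le, ← measure_Iio_eq_cdf,
        ← lintegral_indicator_const measurableSet_Iio]
      refine lintegral_congr_ae ?_
      filter_upwards [ae_mem_timeInterval_iff Q hm hz hs] with y hy
      by_cases hlt : y < preValue z Z s
      · rw [indicator_of_mem (show (y, s) ∈ K from hy.2 hlt), indicator_of_mem (by exact hlt)]
      · rw [indicator_of_notMem (show (y, s) ∉ K from mt hy.1 hlt),
          indicator_of_notMem (by exact hlt)]
    rw [h2]
    by_cases h : s ∈ timeInterval τ
    · rw [indicator_of_mem h]
    · rw [indicator_of_notMem h,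
        cdf_eq_zero_of_nonpos hQ (preValue_nonpos_of_notMem hm hz hτ hs h)]
      simp
  · rw [indicator_of_notMem (fun h => hs h.1)]
    refine (lintegral_eq_zero_of_ae_eq_zero (Eventually.of_forall fun y => ?_)).symm
    exact indicator_of_notMem (show (y, s) ∉ K from fun h => hs h.2.1) _

theorem measurable_discountedValue_hitBelow (hc : ∀ t, ContinuousWithinAt Z (Ici t) t)
    (hm : Antitone Z) (r : ℝ) (hU : Measurable U) :
    Measurable fun y => discountedValue r U Z (hitBelow Z y) :=
  (measurable_discountedValue_prod (Ω := Unit) (Z := fun t _ => Z t) (fun _ => hc) (fun _ => hm)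
    (fun _ => measurable_const) r hU).comp
    (measurable_prodMk_left (x := ()))

theorem measurableSet_value_hitBelow_eq (hm : Antitone Z) :
    MeasurableSet {y | Z (hitBelow Z y).toNNReal = y} :=
  measurableSet_eq_fun (hm.measurable.comp (measurable_hitBelow Z).ennreal_toNNReal) measurable_id

/-- The atoms of the measure `d(-Z)` are the jump times of `Z`. -/
theorem setOf_pathMeasure_singleton_eq_zero (hc : ∀ t, ContinuousWithinAt Z (Ici t) t)
    (hm : Antitone Z) (hz : ∀ t, Z t ≤ z) :
    {s | pathMeasure (-z) (fun t => -Z t) {s} = 0} =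
      {s | 0 ≤ s ∧ Z s.toNNReal < preValue z Z s}ᶜ := by
  have hg : Measurable fun y => (hitBelow Z y).toReal := (measurable_hitBelow Z).ennreal_toReal
  ext s
  rw [mem_ofPred_eq, pathMeasure_neg_eq_map hc hm hz,
    Measure.map_apply hg (measurableSet_singleton s),
    Measure.restrict_apply (hg (measurableSet_singleton s)), mem_compl_iff, mem_ofPred_eq]
  by_cases hs : 0 ≤ s
  · have : ((fun y => (hitBelow Z y).toReal) ⁻¹' {s} ∩ {y | y < z ∧ hitBelow Z y ≠ ∞} : Set ℝ)
        =ᵐ[volume] (Ico (Z s.toNNReal) (preValue z Z s) : Set ℝ) := by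
      refine eventuallyEq_set.2 ?_
      filter_upwards [ae_hitBelow_eq_iff volume hc hm hz hs] with y hy
      rw [← hy]
      constructor
      · rintro ⟨h1, h2, h3⟩
        have h1' : (hitBelow Z y).toReal = s := h1
        exact ⟨h2, by rw [← h1', ENNReal.ofReal_toReal h3]⟩
      · rintro ⟨h1, h2⟩
        refine ⟨?_, h1, by simp [h2]⟩
        change (hitBelow Z y).toReal = s
        rw [h2, ENNReal.toReal_ofReal hs]
    rw [measure_congr this, Real.volume_Ico, ENNReal.ofReal_eq_zero]
    simp [hs]
  · have : (fun y => (hitBelow Z y).toReal) ⁻¹' {s} = ∅ := by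
      refine eq_empty_of_forall_notMem fun y hy => hs ?_
      have hy' : (hitBelow Z y).toReal = s := hy
      exact hy' ▸ ENNReal.toReal_nonneg
    simp [this, hs]

/-- The levels that are passed continuously: there `Z_{τ_y} = y`, and `-dZ^c` is the image of
Lebesgue measure on these levels under the passage time. -/
theorem lintegral_continuousPart_eq (hf : Measurable f)
    (hf0 : ∀ y < 0, f y = 0) (hQ : Q = volume.withDensity fun y => ENNReal.ofReal (f y))
    (hU : Measurable U) (hU0 : ∀ t, 0 ≤ U (Z t))
    (hc : ∀ t, ContinuousWithinAt Z (Ici t) t) (hm : Antitone Z) (hz : ∀ t, Z t ≤ z)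
    (hτ : ∀ s, 0 ≤ s → s ∉ timeInterval τ → ∃ t : ℝ≥0, (t : ℝ) < s ∧ Z t ≤ 0) (r : ℝ) :
    ∫⁻ s in timeInterval τ, ENNReal.ofReal (Real.exp (-r * s) * (U (Z s.toNNReal) *
      f (Z s.toNNReal))) ∂continuousPart (pathMeasure (-z) fun t => -Z t) =
    ∫⁻ y in Iio z ∩ {y | Z (hitBelow Z y).toNNReal = y},
      discountedValue r U Z (hitBelow Z y) ∂Q := by
  have hg : Measurable fun y => (hitBelow Z y).toReal := (measurable_hitBelow Z).ennreal_toReal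
  have hT := measurableSet_timeInterval τ
  have hS : MeasurableSet {s : ℝ | 0 ≤ s ∧ Z s.toNNReal < preValue z Z s}ᶜ :=
    (countable_lt_preValue hm hz).measurableSet.compl
  have hZm : Measurable fun s : ℝ => Z s.toNNReal := hm.measurable.comp measurable_real_toNNReal
  have hW : MeasurableSet {y : ℝ | y < z ∧ hitBelow Z y ≠ ∞} :=
    measurableSet_Iio.inter ((measurable_hitBelow Z (measurableSet_singleton ∞)).compl)
  have hA := measurableSet_value_hitBelow_eq hm
  have hD := measurable_discountedValue_hitBelow hc hm r hU
  have hint : Measurable fun s : ℝ => ENNReal.ofReal (Real.exp (-r * s) *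
      (U (Z s.toNNReal) * f (Z s.toNNReal))) :=
    ((by fun_prop : Measurable fun s : ℝ => Real.exp (-r * s)).mul
      ((hU.comp hZm).mul (hf.comp hZm))).ennreal_ofReal
  rw [continuousPart, setOf_pathMeasure_singleton_eq_zero hc hm hz,
    Measure.restrict_restrict hT, pathMeasure_neg_eq_map hc hm hz,
    setLIntegral_map (hT.inter hS) hint hg,
    Measure.restrict_restrict (hg (hT.inter hS)), ← lintegral_indicator
      ((hg (hT.inter hS)).inter hW), ← lintegral_indicator (measurableSet_Iio.inter hA), hQ,
    lintegral_withDensity_eq_lintegral_mul _ hf.ennreal_ofReal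
      (hD.indicator (measurableSet_Iio.inter hA))]
  refine lintegral_congr_ae ?_
  filter_upwards [ae_lt_preValue_hitBelow_iff volume hc hm hz,
    (countable_singleton (0 : ℝ)).ae_notMem volume] with y hy hy0
  have htime : ((hitBelow Z y).toReal).toNNReal = (hitBelow Z y).toNNReal := Real.toNNReal_coe
  rw [Pi.mul_apply]
  by_cases hyz : y < z
  swap
  · rw [indicator_of_notMem (fun h => hyz h.2.1), indicator_of_notMem (fun h => hyz h.1), mul_zero]
  by_cases htop : hitBelow Z y = ∞
  · rw [indicator_of_notMem (fun h => h.2.2 htop)]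
    simp [indicator, discountedValue, htop]
  by_cases hval : Z (hitBelow Z y).toNNReal = y
  swap
  · have := (hy hyz htop).2 hval
    rw [indicator_of_notMem, indicator_of_notMem (fun h => hval h.2), mul_zero]
    exact fun h => h.1.2 ⟨ENNReal.toReal_nonneg, by rwa [htime]⟩
  rw [indicator_of_mem (show y ∈ Iio z ∩ {y | Z (hitBelow Z y).toNNReal = y} from ⟨hyz, hval⟩)]
  by_cases hin : (hitBelow Z y).toReal ∈ timeInterval τ
  · rw [indicator_of_mem]
    swap
    · refine ⟨⟨hin, fun h => ?_⟩, hyz, htop⟩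
      exact (hy hyz htop).1 (htime ▸ h.2) hval
    rw [htime, discountedValue, if_neg htop, ← mul_assoc,
      ENNReal.ofReal_mul (mul_nonneg (Real.exp_pos _).le (hU0 _)), mul_comm, hval]
  · rw [indicator_of_notMem (fun h => hin h.1.1)]
    rcases lt_or_gt_of_ne hy0 with h0 | h0
    · -- passage after `τ` is possible only for levels below `0`, which carry no density
      simp [hf0 y h0]
    · obtain ⟨t, ht, hZt⟩ := hτ _ ENNReal.toReal_nonneg hin
      have hle : hitBelow Z y ≤ t := iInf₂_le t (hZt.trans (le_of_lt h0))
      exact absurd (ENNReal.toReal_mono ENNReal.coe_ne_top hle) ht.not_ge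

/-- The levels passed by jumps. -/
theorem tsum_cdf_jump_eq [IsProbabilityMeasure Q] [NullSingletonClass Q] (hQ : Q (Iic 0) = 0)
    (hU0 : ∀ t, 0 ≤ U (Z t))
    (hc : ∀ t, ContinuousWithinAt Z (Ici t) t) (hm : Antitone Z) (hz : ∀ t, Z t ≤ z)
    (hτ : ∀ s, 0 ≤ s → s ∉ timeInterval τ → ∃ t : ℝ≥0, (t : ℝ) < s ∧ Z t ≤ 0) (r : ℝ) :
    ∑' s : timeInterval τ, ENNReal.ofReal (Real.exp (-r * s) * (U (Z (s : ℝ).toNNReal) *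
      (cdf Q (preValue z Z s) - cdf Q (Z (s : ℝ).toNNReal)))) =
    ∫⁻ y in Iio z ∩ {y | Z (hitBelow Z y).toNNReal = y}ᶜ,
      discountedValue r U Z (hitBelow Z y) ∂Q := by
  let S : Set ℝ := {s | 0 ≤ s ∧ Z s.toNNReal < preValue z Z s}
  let J : ℝ → Set ℝ := fun s => {y | y < z ∧ hitBelow Z y = ENNReal.ofReal s}
  have hS : S.Countable := countable_lt_preValue hm hz
  have hJ : ∀ s, MeasurableSet (J s) := fun s =>
    measurableSet_Iio.inter (measurable_hitBelow Z (measurableSet_singleton _))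
  have hA := measurableSet_value_hitBelow_eq hm
  have hdisj : S.PairwiseDisjoint J := by
    intro s hs t ht hst
    refine disjoint_left.2 fun y hy hy' => hst ?_
    have h := congrArg ENNReal.toReal (hy.2.symm.trans hy'.2)
    rwa [ENNReal.toReal_ofReal hs.1, ENNReal.toReal_ofReal ht.1] at h
  have hrhs : ∫⁻ y in Iio z ∩ {y | Z (hitBelow Z y).toNNReal = y}ᶜ,
      discountedValue r U Z (hitBelow Z y) ∂Q =
      ∫⁻ y in ⋃ s ∈ S, J s, discountedValue r U Z (hitBelow Z y) ∂Q := by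
    rw [← lintegral_indicator (measurableSet_Iio.inter hA.compl),
      ← lintegral_indicator (MeasurableSet.biUnion hS fun s _ => hJ s)]
    refine lintegral_congr_ae ?_
    filter_upwards [ae_lt_preValue_hitBelow_iff Q hc hm hz] with y hy
    by_cases htop : hitBelow Z y = ∞
    · simp [indicator, discountedValue, htop]
    have htime : ((hitBelow Z y).toReal).toNNReal = (hitBelow Z y).toNNReal := Real.toNNReal_coe
    have hiff : y ∈ Iio z ∩ {y | Z (hitBelow Z y).toNNReal = y}ᶜ ↔ y ∈ ⋃ s ∈ S, J s := by
      simp only [mem_iUnion, exists_prop]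
      constructor
      · rintro ⟨h1, h2⟩
        exact ⟨(hitBelow Z y).toReal,
          ⟨ENNReal.toReal_nonneg, by rw [htime]; exact (hy h1 htop).2 h2⟩,
          h1, (ENNReal.ofReal_toReal htop).symm⟩
      · rintro ⟨s, hs, h1, h2⟩
        refine ⟨h1, (hy h1 htop).1 ?_⟩
        rw [h2, ENNReal.toReal_ofReal hs.1]
        exact hs.2
    by_cases h : y ∈ Iio z ∩ {y | Z (hitBelow Z y).toNNReal = y}ᶜ
    · rw [indicator_of_mem h, indicator_of_mem (hiff.1 h)]
    · rw [indicator_of_notMem h, indicator_of_notMem (mt hiff.2 h)]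
  have hterm : ∀ s : S, ∫⁻ y in J s, discountedValue r U Z (hitBelow Z y) ∂Q =
      ENNReal.ofReal (Real.exp (-r * s) * (U (Z (s : ℝ).toNNReal) *
        (cdf Q (preValue z Z s) - cdf Q (Z (s : ℝ).toNNReal)))) := by
    rintro ⟨s, hs⟩
    have hQJ : Q (J s) = Q (Ico (Z s.toNNReal) (preValue z Z s)) :=
      measure_congr (eventuallyEq_set.2 (ae_hitBelow_eq_iff Q hc hm hz hs.1))
    rw [setLIntegral_congr_fun (g := fun _ => ENNReal.ofReal
      (Real.exp (-r * s) * U (Z s.toNNReal))) (hJ s), setLIntegral_const,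
      hQJ, measure_Ico_eq_cdf, ← ENNReal.ofReal_mul (mul_nonneg (Real.exp_pos _).le (hU0 _)),
      mul_assoc]
    intro y hy
    have h2 : hitBelow Z y = ENNReal.ofReal s := hy.2
    simp only [discountedValue, h2, ENNReal.ofReal_ne_top, if_false]
    rw [ENNReal.toReal_ofReal hs.1]
    rfl
  rw [hrhs, lintegral_biUnion hS (fun s _ => hJ s) hdisj, tsum_congr hterm,
    tsum_subtype (timeInterval τ) fun s : ℝ => ENNReal.ofReal (Real.exp (-r * s) *
      (U (Z s.toNNReal) * (cdf Q (preValue z Z s) - cdf Q (Z s.toNNReal)))),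
    tsum_subtype S fun s : ℝ => ENNReal.ofReal (Real.exp (-r * s) *
      (U (Z s.toNNReal) * (cdf Q (preValue z Z s) - cdf Q (Z s.toNNReal))))]
  refine tsum_congr fun s => ?_
  by_cases hs : 0 ≤ s
  swap
  · rw [indicator_of_notMem (fun h => hs h.1), indicator_of_notMem (fun h => hs h.1)]
  by_cases h1 : s ∈ timeInterval τ <;> by_cases h2 : s ∈ S
  · rw [indicator_of_mem h1, indicator_of_mem h2]
  · rw [indicator_of_mem h1, indicator_of_notMem h2]
    -- `Z` does not jump at `s`
    have : preValue z Z s = Z s.toNNReal :=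
      le_antisymm (not_lt.1 fun h => h2 ⟨hs, h⟩) (le_preValue_self hm hz)
    simp [this]
  · rw [indicator_of_notMem h1, indicator_of_mem h2]
    have h0 := preValue_nonpos_of_notMem hm hz hτ hs h1
    rw [cdf_eq_zero_of_nonpos hQ h0, cdf_eq_zero_of_nonpos hQ ((le_preValue_self hm hz).trans h0)]
    simp
  · rw [indicator_of_notMem h1, indicator_of_notMem h2]

end Pathwise

/-- The path properties on which the reward identity rests. They hold almost surely for an
admissible control `L` and its controlled process `X`; lower semicontinuity of `X` expresses that
its jumps are downward. -/
structure IsRegularPath (U : ℝ → ℝ) (L X : ℝ≥0 → ℝ) : Prop where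
  nonneg : 0 ≤ L 0
  mono : Monotone L
  rightCont : ∀ t, ContinuousWithinAt L (Ici t) t
  rightCont_state : ∀ t, ContinuousWithinAt X (Ici t) t
  lowerSemicontinuous_state : LowerSemicontinuous X
  reward_nonneg : ∀ t, 0 ≤ U (X t)

/-! ### Regular paths -/

section RegularPath

variable {U : ℝ → ℝ} {L X : ℝ≥0 → ℝ} {r x : ℝ}

theorem IsRegularPath.reward_runMin_nonneg (h : IsRegularPath U L X) (hx : 0 ≤ U x) (t : ℝ≥0) :
    0 ≤ U (runMin x X t) := by
  obtain ⟨s, -, heq, -⟩ := exists_runMin_eq h.lowerSemicontinuous_state x t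
  rw [heq]
  rcases min_choice x (X s) with h' | h' <;> rw [h']
  exacts [hx, h.reward_nonneg s]

/-- The reward depends on the controlled process only through its running minimum. -/
theorem IsRegularPath.pathReward_eq (h : IsRegularPath U L X) (r x y : ℝ) :
    pathReward r U x L X y = if x ≤ y then ENNReal.ofReal (U x) else
      (∫⁻ s in timeInterval (hitBelow (runMin x X) y),
        ENNReal.ofReal (Real.exp (-r * s)) ∂pathMeasure 0 L) +
      discountedValue r U (runMin x X) (hitBelow (runMin x X) y) := by
  unfold pathReward
  split_ifs with hy
  · rfl
  · have hy' := not_le.1 hy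
    rw [hitBelow_runMin h.lowerSemicontinuous_state h.rightCont_state hy']
    congr 1
    unfold discountedValue
    split_ifs with htop
    · rfl
    · rw [runMin_hitBelow h.lowerSemicontinuous_state h.rightCont_state hy' htop]

theorem IsRegularPath.exists_runMin_nonpos (h : IsRegularPath U L X) {s : ℝ} (hs : 0 ≤ s)
    (hmem : s ∉ timeInterval (hitBelow X 0)) :
    ∃ t : ℝ≥0, (t : ℝ) < s ∧ runMin x X t ≤ 0 := by
  have hlt : hitBelow X 0 < ENNReal.ofReal s := not_le.1 fun h' => hmem ⟨hs, h'⟩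
  obtain ⟨t, ht⟩ := iInf_lt_iff.1 hlt
  obtain ⟨h0, ht⟩ := iInf_lt_iff.1 ht
  exact ⟨t, Real.lt_toNNReal_iff_coe_lt.1 (ENNReal.coe_lt_coe.1 ht),
    (runMin_le_iff h.lowerSemicontinuous_state t).2 (Or.inr ⟨t, le_rfl, h0⟩)⟩

end RegularPath

/-! ### The law of the threshold -/

section ThresholdLaw

variable {Q : Measure ℝ} {f : ℝ → ℝ}

theorem IsThresholdLaw.measurable (h : IsThresholdLaw Q f) : Measurable f := by
  obtain ⟨b, -, ⟨K, hK⟩, -, h0⟩ := h.shape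
  classical
  have hpw : f = (Icc 0 b).piecewise f 0 := by
    ext y
    by_cases hy : y ∈ Icc 0 b
    · rw [piecewise_eq_of_mem _ _ _ hy]
    · rw [piecewise_eq_of_notMem _ _ _ hy, h0 y hy, Pi.zero_apply]
  rw [hpw]
  exact hK.continuousOn.measurable_piecewise continuousOn_const measurableSet_Icc

theorem IsThresholdLaw.eq_zero_of_neg (h : IsThresholdLaw Q f) {y : ℝ} (hy : y < 0) : f y = 0 := by
  obtain ⟨b, -, -, -, h0⟩ := h.shape
  exact h0 y fun hmem => hmem.1.not_gt hy

theorem IsThresholdLaw.absolutelyContinuous (h : IsThresholdLaw Q f) : Q ≪ volume := by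
  rw [h.density]
  exact withDensity_absolutelyContinuous _ _

theorem IsThresholdLaw.nullSingletonClass (h : IsThresholdLaw Q f) : NullSingletonClass Q :=
  ⟨fun y => h.absolutelyContinuous (measure_singleton y)⟩

theorem IsThresholdLaw.measure_Iic_zero (h : IsThresholdLaw Q f) : Q (Iic 0) = 0 := by
  have := h.nullSingletonClass
  rw [← measure_congr (Iio_ae_eq_Iic (μ := Q)), h.density, withDensity_apply _ measurableSet_Iio]
  exact setLIntegral_eq_zero measurableSet_Iio fun y hy => by
    rw [h.eq_zero_of_neg hy, ENNReal.ofReal_zero, Pi.zero_apply]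

theorem IsThresholdLaw.ofReal_mul_measure_Ici (h : IsThresholdLaw Q f) {u : ℝ} (hu : 0 ≤ u)
    (x : ℝ) : ENNReal.ofReal u * Q (Ici x) = ENNReal.ofReal (u * (1 - cdf Q x)) := by
  have := h.isProbabilityMeasure
  have := h.nullSingletonClass
  have hQ : Q (Ici x) = ENNReal.ofReal (1 - cdf Q x) := by
    rw [← compl_Iio, prob_compl_eq_one_sub measurableSet_Iio, measure_Iio_eq_cdf,
      ENNReal.ofReal_sub _ (cdf_nonneg Q x), ENNReal.ofReal_one]
  rw [hQ, ENNReal.ofReal_mul hu]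

end ThresholdLaw

/-! ### The reward identity for a fixed control -/

section Rewards

variable {Ω : Type*} [MeasurableSpace Ω] {P : Measure Ω} {Q : Measure ℝ} {U f : ℝ → ℝ} {r x : ℝ}
  {L X : ℝ≥0 → Ω → ℝ}

/-- The reward identity for a fixed control, all of whose paths are regular. -/
theorem tippingReward_eq_of_regular [IsProbabilityMeasure P] (hQ : IsThresholdLaw Q f)
    (hU : Measurable U) (hx : 0 ≤ U x)
    (hreg : ∀ ω, IsRegularPath U (fun t => L t ω) (fun t => X t ω))
    (hL : ∀ t, Measurable (L t)) (hX : ∀ t, Measurable (X t)) :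
    tippingReward P Q r U x L X =
      singularReward P (cdf Q) f r U x L X + ENNReal.ofReal (U x) * Q (Ici x) := by
  have := hQ.isProbabilityMeasure
  have := hQ.nullSingletonClass
  let M : ℝ≥0 → Ω → ℝ := fun t ω => runMin x (fun s => X s ω) t
  have hMc : ∀ ω t, ContinuousWithinAt (fun s => M s ω) (Ici t) t := fun ω =>
    continuousWithinAt_runMin (hreg ω).lowerSemicontinuous_state (hreg ω).rightCont_state
  have hMm : ∀ ω, Antitone fun t => M t ω := fun ω =>
    antitone_runMin (hreg ω).lowerSemicontinuous_state
  have hMx : ∀ ω t, M t ω ≤ x := fun ω t => runMin_le _ t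
  have hM : ∀ t, Measurable (M t) := measurable_runMin
    (fun ω => (hreg ω).lowerSemicontinuous_state) (fun ω => (hreg ω).rightCont_state) hX x
  have hMU : ∀ ω t, 0 ≤ U (M t ω) := fun ω => (hreg ω).reward_runMin_nonneg hx
  let A : Ω × ℝ → ℝ≥0∞ := fun p => ∫⁻ s in timeInterval (hitBelow (fun t => M t p.1) p.2),
    ENNReal.ofReal (Real.exp (-r * s)) ∂pathMeasure 0 fun t => L t p.1
  let D : Ω × ℝ → ℝ≥0∞ := fun p =>
    discountedValue r U (fun t => M t p.1) (hitBelow (fun t => M t p.1) p.2)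
  -- the threshold is reached without overshoot
  let C : Set (Ω × ℝ) := {p | M (hitBelow (fun t => M t p.1) p.2).toNNReal p.1 = p.2}
  have hA : Measurable A := measurable_lintegral_timeInterval (fun ω => (hreg ω).rightCont)
    (fun ω => (hreg ω).mono) (fun ω => (hreg ω).nonneg) hL r (measurable_hitBelow_prod hMc hMm hM)
  have hD : Measurable D := measurable_discountedValue_prod hMc hMm hM r hU
  have hC : MeasurableSet C :=
    measurableSet_eq_fun (measurable_value_hitBelow_prod hMc hMm hM) measurable_snd
  have hI : MeasurableSet {p : Ω × ℝ | x ≤ p.2} := measurableSet_le measurable_const measurable_snd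
  -- the three terms of the singular control problem as integrals over the threshold
  have hext : extractionTerm P (cdf Q) r x L X = ∫⁻ ω, ∫⁻ y in Iio x, A (ω, y) ∂Q ∂P :=
    lintegral_congr fun ω => lintegral_cdf_preValue_eq hQ.measure_Iic_zero (hMm ω) (hMx ω)
      (fun s hs hmem => (hreg ω).exists_runMin_nonpos hs hmem) r _
  have hcont : continuousTerm P f r U x X =
      ∫⁻ ω, ∫⁻ y in Iio x ∩ Prod.mk ω ⁻¹' C, D (ω, y) ∂Q ∂P :=
    lintegral_congr fun ω => lintegral_continuousPart_eq hQ.measurable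
      (fun y hy => hQ.eq_zero_of_neg hy) hQ.density hU (hMU ω) (hMc ω) (hMm ω) (hMx ω)
      (fun s hs hmem => (hreg ω).exists_runMin_nonpos hs hmem) r
  have hjump : jumpTerm P (cdf Q) r U x X =
      ∫⁻ ω, ∫⁻ y in Iio x ∩ (Prod.mk ω ⁻¹' C)ᶜ, D (ω, y) ∂Q ∂P :=
    lintegral_congr fun ω => tsum_cdf_jump_eq hQ.measure_Iic_zero (hMU ω) (hMc ω) (hMm ω) (hMx ω)
      (fun s hs hmem => (hreg ω).exists_runMin_nonpos hs hmem) r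
  have hCω : ∀ ω, MeasurableSet (Prod.mk ω ⁻¹' C) := fun ω => measurable_prodMk_left hC
  have hcont_meas : Measurable fun ω => ∫⁻ y in Iio x ∩ Prod.mk ω ⁻¹' C, D (ω, y) ∂Q := by
    have : ∀ ω, ∫⁻ y in Iio x ∩ Prod.mk ω ⁻¹' C, D (ω, y) ∂Q =
        ∫⁻ y in Iio x, C.indicator D (ω, y) ∂Q := fun ω => by
      rw [inter_comm, ← Measure.restrict_restrict (hCω ω), ← lintegral_indicator (hCω ω)]
      rfl
    simp_rw [this]
    exact (hD.indicator hC).lintegral_prod_right'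
  have hreward : ∀ p : Ω × ℝ, pathReward r U x (fun t => L t p.1) (fun t => X t p.1) p.2 =
      if x ≤ p.2 then ENNReal.ofReal (U x) else A p + D p :=
    fun p => (hreg p.1).pathReward_eq r x p.2
  have hinner : ∀ ω, ∫⁻ y, (if x ≤ y then ENNReal.ofReal (U x) else A (ω, y) + D (ω, y)) ∂Q =
      ∫⁻ y in Iio x, A (ω, y) ∂Q + (∫⁻ y in Iio x ∩ Prod.mk ω ⁻¹' C, D (ω, y) ∂Q +
        (∫⁻ y in Iio x ∩ (Prod.mk ω ⁻¹' C)ᶜ, D (ω, y) ∂Q +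
          ENNReal.ofReal (U x) * Q (Ici x))) := fun ω => by
    rw [← lintegral_add_compl _ (measurableSet_Iio (a := x)), compl_Iio,
      setLIntegral_congr_fun (g := fun y => A (ω, y) + D (ω, y)) measurableSet_Iio
        (fun y hy => if_neg (not_le.2 hy)),
      setLIntegral_congr_fun (s := Ici x) (g := fun _ => ENNReal.ofReal (U x)) measurableSet_Ici
        (fun y hy => if_pos (mem_Ici.1 hy)),
      setLIntegral_const,
      lintegral_add_left (f := fun y => A (ω, y)) (hA.comp measurable_prodMk_left),
      ← lintegral_inter_add_sdiff (fun y => D (ω, y)) (Iio x) (hCω ω), add_assoc, add_assoc]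
    rfl
  have hmeas : Measurable fun p : Ω × ℝ =>
      if x ≤ p.2 then ENNReal.ofReal (U x) else A p + D p :=
    Measurable.ite hI measurable_const (hA.add hD)
  unfold tippingReward singularReward
  simp_rw [hreward]
  rw [lintegral_prod _ hmeas.aemeasurable]
  simp_rw [hinner]
  rw [lintegral_add_left hA.lintegral_prod_right', lintegral_add_left hcont_meas,
    lintegral_add_right _ measurable_const, lintegral_const, measure_univ, mul_one, hext, hcont,
    hjump, add_assoc, add_assoc]

theorem tippingReward_congr [SFinite P] [SFinite Q] {L' X' : ℝ≥0 → Ω → ℝ}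
    (h : ∀ᵐ ω ∂P, (∀ t, L t ω = L' t ω) ∧ ∀ t, X t ω = X' t ω) :
    tippingReward P Q r U x L X = tippingReward P Q r U x L' X' := by
  refine lintegral_congr_ae ?_
  filter_upwards [Measure.quasiMeasurePreserving_fst.ae h] with p hp
  simp only [hp.1, hp.2]

theorem singularReward_congr {F : ℝ → ℝ} {m : ℝ} {L' X' : ℝ≥0 → Ω → ℝ}
    (h : ∀ᵐ ω ∂P, (∀ t, L t ω = L' t ω) ∧ ∀ t, X t ω = X' t ω) :
    singularReward P F f r U m L X = singularReward P F f r U m L' X' := by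
  unfold singularReward
  congr 1
  · congr 1
    · refine lintegral_congr_ae ?_
      filter_upwards [h] with ω hω
      simp only [hω.1, hω.2]
    · refine lintegral_congr_ae ?_
      filter_upwards [h] with ω hω
      simp only [hω.2]
  · refine lintegral_congr_ae ?_
    filter_upwards [h] with ω hω
    rw [show (fun t => X t ω) = fun t => X' t ω from funext hω.2]

/-- The reward identity when almost all paths are regular: completeness of `P` allows to change the
processes on the exceptional null set. -/
theorem tippingReward_eq [IsProbabilityMeasure P] [P.IsComplete] (hQ : IsThresholdLaw Q f)
    (hU : Measurable U) (hx : 0 ≤ U x)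
    (hreg : ∀ᵐ ω ∂P, IsRegularPath U (fun t => L t ω) (fun t => X t ω))
    (hL : ∀ t, Measurable (L t)) (hX : ∀ t, Measurable (X t)) :
    tippingReward P Q r U x L X =
      singularReward P (cdf Q) f r U x L X + ENNReal.ofReal (U x) * Q (Ici x) := by
  classical
  have := hQ.isProbabilityMeasure
  let G : Set Ω := {ω | IsRegularPath U (fun t => L t ω) (fun t => X t ω)}
  have hG : MeasurableSet G := by
    rw [← compl_compl G]
    exact (measurableSet_of_null hreg).compl
  let L' : ℝ≥0 → Ω → ℝ := fun t ω => if ω ∈ G then L t ω else 0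
  let X' : ℝ≥0 → Ω → ℝ := fun t ω => if ω ∈ G then X t ω else x
  have hcongr : ∀ᵐ ω ∂P, (∀ t, L t ω = L' t ω) ∧ ∀ t, X t ω = X' t ω := by
    filter_upwards [hreg] with ω hω
    exact ⟨fun t => (if_pos (show ω ∈ G from hω)).symm,
      fun t => (if_pos (show ω ∈ G from hω)).symm⟩
  rw [tippingReward_congr hcongr, singularReward_congr hcongr]
  refine tippingReward_eq_of_regular hQ hU hx (fun ω => ?_)
    (fun t => Measurable.ite hG (hL t) measurable_const)
    (fun t => Measurable.ite hG (hX t) measurable_const)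
  by_cases hω : ω ∈ G
  · simp only [L', X', if_pos hω]
    exact hω
  · simp only [L', X', if_neg hω]
    exact ⟨le_rfl, monotone_const, fun _ => continuousWithinAt_const,
      fun _ => continuousWithinAt_const, continuous_const.lowerSemicontinuous, fun _ => hx⟩

end Rewards

/-! ### Almost all paths of an admissible control are regular -/

section Admissible

/-- The jumps of `-L` are downward. -/
theorem lowerSemicontinuous_neg_of_rightCont {L : ℝ≥0 → ℝ} (hm : Monotone L)
    (hc : ∀ t, ContinuousWithinAt L (Ici t) t) : LowerSemicontinuous fun t => -L t := by
  intro t c hct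
  obtain ⟨u, hu, hIco⟩ := mem_nhdsGE_iff_exists_Ico_subset.1 ((hc t).neg.eventually_const_lt hct)
  filter_upwards [Iio_mem_nhds (show t < u from hu)] with s hs
  rcases le_or_gt s t with hst | hst
  · exact hct.trans_le (neg_le_neg (hm hst))
  · exact hIco ⟨hst.le, hs⟩

theorem continuous_primitive_nnreal {g : ℝ → ℝ}
    (hg : ∀ t : ℝ≥0, IntervalIntegrable g volume 0 t) :
    Continuous fun t : ℝ≥0 => ∫ s in (0 : ℝ)..t, g s := by
  refine continuous_iff_continuousAt.2 fun t => ?_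
  have h := intervalIntegral.continuousOn_primitive_interval' (hg (t + 1)) left_mem_uIcc
  have hmaps : ∀ s ∈ Iio (t + 1), (s : ℝ) ∈ uIcc (0 : ℝ) ((t + 1 : ℝ≥0) : ℝ) := fun s hs =>
    mem_uIcc_of_le s.coe_nonneg (NNReal.coe_le_coe.2 (le_of_lt hs))
  have ht : t ∈ Iio (t + 1) := lt_add_of_pos_right t one_pos
  exact ((h _ (hmaps t ht)).comp (f := fun s : ℝ≥0 => (s : ℝ))
    NNReal.continuous_coe.continuousWithinAt hmaps).continuousAt (Iio_mem_nhds ht)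

variable {Ω : Type*} [MeasurableSpace Ω] {P : Measure Ω} {𝓕 : Filtration ℝ≥0 ‹MeasurableSpace Ω›}
  {B L X : ℝ≥0 → Ω → ℝ} {α : EReal} {μ σ U : ℝ → ℝ} {x : ℝ}

theorem IsAdmissible.ae_isRegularPath (h : IsAdmissible 𝓕 P B α μ σ x L X)
    (hU : ∀ y ∈ stateSpace α, 0 ≤ U y) :
    ∀ᵐ ω ∂P, IsRegularPath U (fun t => L t ω) (fun t => X t ω) := by
  obtain ⟨I, hI, heq⟩ := h.diffusion.equation
  filter_upwards [h.control.mono, h.control.rightCont, h.diffusion.drift_integrable, hI.continuous,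
    heq, h.mem_stateSpace] with ω h1 h2 h3 h4 h5 h6
  have hcont : Continuous fun t : ℝ≥0 =>
      x + (∫ s in (0 : ℝ)..t, μ (X s.toNNReal ω)) + I t ω :=
    (continuous_const.add (continuous_primitive_nnreal h3)).add h4
  have hX : (fun t => X t ω) = fun t : ℝ≥0 =>
      x + (∫ s in (0 : ℝ)..t, μ (X s.toNNReal ω)) + I t ω + -L t ω := by
    ext t
    rw [h5 t, sub_eq_add_neg]
  refine ⟨h1.1, h1.2, h2, ?_, ?_, fun t => hU _ (h6 t)⟩
  · rw [hX]
    exact fun t => hcont.continuousWithinAt.add (h2 t).neg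
  · rw [hX]
    exact hcont.lowerSemicontinuous.add (lowerSemicontinuous_neg_of_rightCont h1.2 h2)

end Admissible

end TippingPoint

theorem proposition1 {Ω : Type*} [MeasurableSpace Ω] (P : Measure Ω) [IsProbabilityMeasure P]
    [P.IsComplete] (B : ℝ≥0 → Ω → ℝ) (hB : IsBrownianReal B P)
    (α : EReal) (hα : α < 0) (μ σ : ℝ → ℝ)
    (hμ : ∃ K : ℝ≥0, LipschitzOnWith K μ (stateSpace α))
    (hσ : ∃ K : ℝ≥0, LipschitzOnWith K σ (stateSpace α))
    (hσ_pos : ∀ y ∈ stateSpace α, 0 < σ y)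
    (r : ℝ) (U : ℝ → ℝ) (hU : Measurable U) (hU_nonneg : ∀ y ∈ stateSpace α, 0 ≤ U y)
    (Q : Measure ℝ) (f : ℝ → ℝ) (hQ : IsThresholdLaw Q f)
    (x : ℝ) (hx : x ∈ stateSpace α) :
    tippingValue (brownianFiltration hB) P B α μ σ Q r U x =
      singularValue (brownianFiltration hB) P B α μ σ (cdf Q) f r U x x +
        ((U x * (1 - cdf Q x) : ℝ) : EReal) := by
  have hc : 0 ≤ U x * (1 - cdf Q x) :=
    mul_nonneg (hU_nonneg x hx) (sub_nonneg.2 (cdf_le_one Q x))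
  have key : ∀ L X, IsAdmissible (brownianFiltration hB) P B α μ σ x L X →
      ((tippingReward P Q r U x L X : ℝ≥0∞) : EReal) =
        ((singularReward P (cdf Q) f r U x L X : ℝ≥0∞) : EReal) +
          ((U x * (1 - cdf Q x) : ℝ) : EReal) := by
    intro L X hLX
    rw [tippingReward_eq hQ hU (hU_nonneg x hx) (hLX.ae_isRegularPath hU_nonneg)
      (fun t => (hLX.control.adapted t).mono ((brownianFiltration hB).le t) le_rfl)
      (fun t => (hLX.diffusion.adapted t).mono ((brownianFiltration hB).le t) le_rfl),
      hQ.ofReal_mul_measure_Ici (hU_nonneg x hx), EReal.coe_ennreal_add,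
      EReal.coe_ennreal_ofReal, max_eq_left hc]
  refine le_antisymm ?_ ?_
  · refine iSup_le fun L => iSup_le fun X => iSup_le fun hLX => ?_
    rw [key L X hLX]
    gcongr
    exact le_iSup_of_le L (le_iSup_of_le X (le_iSup_of_le hLX le_rfl))
  · -- subtracting the finite constant avoids the question whether suprema commute with addition
    have hne : ((U x * (1 - cdf Q x) : ℝ) : EReal) ≠ ⊥ ∨
        tippingValue (brownianFiltration hB) P B α μ σ Q r U x ≠ ⊥ := Or.inl (EReal.coe_ne_bot _)
    have hne' : ((U x * (1 - cdf Q x) : ℝ) : EReal) ≠ ⊤ ∨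
        tippingValue (brownianFiltration hB) P B α μ σ Q r U x ≠ ⊤ := Or.inl (EReal.coe_ne_top _)
    rw [← EReal.le_sub_iff_add_le hne hne']
    refine iSup_le fun L => iSup_le fun X => iSup_le fun hLX => ?_
    rw [EReal.le_sub_iff_add_le hne hne', ← key L X hLX, tippingValue]
    exact le_iSup_of_le L (le_iSup_of_le X (le_iSup_of_le hLX le_rfl))
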